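/- Let $\Omega$ be a locally compact Hausdorff space with a $\sigma$-finite positive Borel measure $\mu$. "Measurable" for complex functions on $\Omega$ means $\mu$-measurable. Let $(H_s)_{s\in\Omega}$ be a family of complex Hilbert spaces with a measurable field structure, that is, a set $\mathcal F$ of sections $x$ ($x(s)\in H_s$ for all $s$) such that: (1) $s\mapsto\langle x(s),y(s)\rangle_s$ is measurable for all $x,y\in\mathcal F$; (2) every section $z$ for which $s\mapsto\langle x(s),z(s)\rangle_s$ is measurable for all $x\in\mathcal F$ belongs to $\mathcal F$; (3) there is a sequence $(\xi_i)$ in $\mathcal F$ such that $\{\xi_i(s)\}_i$ is dense in $H_s$ for every $s\in\Omega$. The direct integral $\int_\Omega^\oplus H_s\,d\mu(s)$ is the space of all $x\in\mathcal F$ with $\int_\Omega\|x(s)\|_s^2\,d\mu(s)<\infty$, modulo sections that vanish $\mu$-a.e., with inner product $\langle x,y\rangle=\int_\Omega\langle x(s),y(s)\rangle_s\,d\mu(s)$. For a linear operator $B:D(B)\subset X\to X$ on a complex Hilbert space $X$, $\rho(B)$ is the set of $\lambda\in\mathbb C$ for which $\lambda-B:D(B)\to X$ is bijective with bounded inverse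 $R(\lambda,B)=(\lambda-B)^{-1}$, and $\sigma(B)=\mathbb C\setminus\rho(B)$. A family $\{T(s)\in\mathcal B(H_s)\}$, defined for a.e. $s$, is a bounded measurable field of operators if $s\mapsto\langle T(s)x(s),y(s)\rangle_s$ is measurable for all $x,y\in\mathcal F$ and $\operatorname{ess\,sup}_{s}\|T(s)\|_{\mathcal B(H_s)}<\infty$. Let $\{A(s):D(A(s))\subset H_s\to H_s\}_{s\in\Omega}$ be a measurable field of closed operators: every $A(s)$ is a closed linear operator, not necessarily densely defined, and there is a fixed $\nu\in\mathbb C$ such that $\nu\in\rho(A(s))$ for a.e. $s$ and $\{R(\nu,A(s))\}$ is a bounded measurable field of operators. Let $A=\int_\Omega^\oplus A(s)\,d\mu(s)$ be the operator on $\int_\Omega^\oplus H_s\,d\mu(s)$ whose domain consists of all $x$ with $x(s)\in D(A(s))$ for a.e. $s$ and $A(\cdot)x(\cdot)\in\int_\Omega^\oplus H_s\,d\mu(s)$, and with $Ax=A(\cdot)x(\cdot)$. Then: (i) $$\rho(A)=\Big\{\lambda\in\mathbb C:\ \lambda\in\rho(A(s))\text{ for a.e. }s\in\Omega\text{ and }\operatorname*{ess\,sup}_{s\in\Omega}\|R(\lambda,A(s))\|_{\mathcal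 B(H_s)}<\infty\Big\},$$ and for every $\lambda\in\rho(A)$ the family $\{R(\lambda,A(s))\}$ is a bounded measurable field of operators and $$R(\lambda,A)=\int_\Omega^\oplus R(\lambda,A(s))\,d\mu(s).$$ (ii) $$\sigma(A)=\Big\{\lambda\in\mathbb C:\ \text{there is a measurable }G\subset\Omega\text{ with }\mu(G)>0\text{ and }\lambda\in\sigma(A(s))\text{ for all }s\in G\Big\}$$ $$\cup\ \Big\{\lambda\in\mathbb C:\ \lambda\in\rho(A(s))\text{ for a.e. }s\in\Omega\text{ and }\operatorname*{ess\,sup}_{s\in\Omega}\|R(\lambda,A(s))\|_{\mathcal B(H_s)}=\infty\Big\}.$$ -/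

import Mathlib

open MeasureTheory Filter
open scoped ENNReal

noncomputable section

/-! ### Resolvent set, spectrum and resolvent of an unbounded operator -/

namespace UnboundedOperator

variable {E : Type*} [NormedAddCommGroup E] [NormedSpace ℂ E]

/-- The bounded operator `R` is a two-sided inverse of `z - B : D(B) → E`. -/
def IsResolventAt (B : E →ₗ.[ℂ] E) (z : ℂ) (R : E →L[ℂ] E) : Prop :=
  (∀ y : E, ∃ h : R y ∈ B.domain, z • R y - B ⟨R y, h⟩ = y) ∧
    ∀ x : B.domain, R (z • (x : E) - B x) = x

/-- `ρ(B)`: the `z` for which `z - B : D(B) → E` is bijective with bounded inverse. -/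
def resolventSet (B : E →ₗ.[ℂ] E) : Set ℂ := {z | ∃ R : E →L[ℂ] E, IsResolventAt B z R}

/-- `σ(B) = ℂ \ ρ(B)`. -/
def spectrum (B : E →ₗ.[ℂ] E) : Set ℂ := (resolventSet B)ᶜ

open scoped Classical in
/-- `R(z, B) = (z - B)⁻¹` for `z ∈ ρ(B)` (and `0` by convention for `z ∉ ρ(B)`). -/
def resolvent (z : ℂ) (B : E →ₗ.[ℂ] E) : E →L[ℂ] E :=
  if h : ∃ R : E →L[ℂ] E, IsResolventAt B z R then h.choose else 0

theorem isResolventAt_unique {B : E →ₗ.[ℂ] E} {z : ℂ} {R S : E →L[ℂ] E}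
    (hR : IsResolventAt B z R) (hS : IsResolventAt B z S) : R = S := by
  ext y
  obtain ⟨h, hy⟩ := hS.1 y
  have := hR.2 ⟨S y, h⟩
  rwa [hy] at this

theorem isResolventAt_resolvent {B : E →ₗ.[ℂ] E} {z : ℂ} (h : z ∈ resolventSet B) :
    IsResolventAt B z (resolvent z B) := by
  have h' : ∃ R : E →L[ℂ] E, IsResolventAt B z R := h
  rw [resolvent, dif_pos h']
  exact h'.choose_spec

/-- An everywhere defined bounded operator, seen as an operator with domain `E`. -/
def ofBounded (T : E →L[ℂ] E) : E →ₗ.[ℂ] E := (T : E →ₗ[ℂ] E).toPMap ⊤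

end UnboundedOperator

/-! ### Measurable fields of Hilbert spaces and their direct integrals -/

/-- A choice of measurable sections which makes the Hilbert bundle `(H s)_{s ∈ Ω}` a measurable
field of Hilbert spaces; `μ`-measurable means almost everywhere equal to a measurable function. -/
structure HilbertField {Ω : Type*} [MeasurableSpace Ω] (μ : Measure Ω) (H : Ω → Type*)
    [∀ s, NormedAddCommGroup (H s)] [∀ s, InnerProductSpace ℂ (H s)] where
  /-- The measurable sections. -/
  sections : Set (∀ s, H s)
  aemeasurable_inner : ∀ x ∈ sections, ∀ y ∈ sections,
    AEMeasurable (fun s => inner ℂ (x s) (y s)) μ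
  mem_sections : ∀ z : ∀ s, H s,
    (∀ x ∈ sections, AEMeasurable (fun s => inner ℂ (x s) (z s)) μ) → z ∈ sections
  exists_fundamental : ∃ ξ : ℕ → ∀ s, H s, (∀ i, ξ i ∈ sections) ∧
    ∀ s, DenseRange fun i => ξ i s

namespace HilbertField

variable {Ω : Type*} [MeasurableSpace Ω] {μ : Measure Ω} {H : Ω → Type*}
  [∀ s, NormedAddCommGroup (H s)] [∀ s, InnerProductSpace ℂ (H s)] (F : HilbertField μ H)

theorem add_mem_sections {x y : ∀ s, H s} (hx : x ∈ F.sections) (hy : y ∈ F.sections) :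
    x + y ∈ F.sections := by
  refine F.mem_sections _ fun w hw => ?_
  simpa only [Pi.add_apply, inner_add_right] using!
    (F.aemeasurable_inner w hw x hx).add (F.aemeasurable_inner w hw y hy)

theorem smul_mem_sections (c : ℂ) {x : ∀ s, H s} (hx : x ∈ F.sections) :
    c • x ∈ F.sections := by
  refine F.mem_sections _ fun w hw => ?_
  simpa only [Pi.smul_apply, inner_smul_right] using!
    (F.aemeasurable_inner w hw x hx).const_mul c

theorem zero_mem_sections : (0 : ∀ s, H s) ∈ F.sections :=
  F.mem_sections _ fun w _ => by simp

theorem aemeasurable_norm_sq {x : ∀ s, H s} (hx : x ∈ F.sections) :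
    AEMeasurable (fun s => ‖x s‖ ^ 2) μ := by
  have h := Complex.measurable_re.comp_aemeasurable (F.aemeasurable_inner x hx x hx)
  refine h.congr (Eventually.of_forall fun s => ?_)
  simp [inner_self_eq_norm_sq_to_K, ← Complex.ofReal_pow]

/-- The measurable sections `x` with `∫ ‖x(s)‖² dμ(s) < ∞`. -/
def l2Sections : Submodule ℂ (∀ s, H s) where
  carrier := {x | x ∈ F.sections ∧ Integrable (fun s => ‖x s‖ ^ 2) μ}
  zero_mem' := ⟨F.zero_mem_sections, by simp⟩
  add_mem' := by
    rintro x y ⟨hx, hx'⟩ ⟨hy, hy'⟩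
    refine ⟨F.add_mem_sections hx hy, ((hx'.add hy').const_mul 2).mono'
      (F.aemeasurable_norm_sq (F.add_mem_sections hx hy)).aestronglyMeasurable
      (Eventually.of_forall fun s => ?_)⟩
    have h := norm_add_le (x s) (y s)
    have h0 := norm_nonneg (x s + y s)
    rw [Real.norm_of_nonneg (sq_nonneg _)]
    simp only [Pi.add_apply]
    nlinarith [sq_nonneg (‖x s‖ - ‖y s‖)]
  smul_mem' := by
    rintro c x ⟨hx, hx'⟩
    refine ⟨F.smul_mem_sections c hx, ?_⟩
    simpa [norm_smul, mul_pow] using hx'.const_mul (‖c‖ ^ 2)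

/-- The square integrable measurable sections that vanish `μ`-almost everywhere. -/
def nullSections : Submodule ℂ F.l2Sections where
  carrier := {x | ∀ᵐ s ∂μ, x.1 s = 0}
  zero_mem' := by
    change ∀ᵐ s ∂μ, (0 : F.l2Sections).1 s = 0
    simp
  add_mem' := by
    intro x y hx hy
    change ∀ᵐ s ∂μ, (x + y).1 s = 0
    filter_upwards [hx, hy] with s h1 h2
    simp [h1, h2]
  smul_mem' := by
    intro c x hx
    change ∀ᵐ s ∂μ, (c • x).1 s = 0
    filter_upwards [hx] with s h1
    simp [h1]

/-- The direct integral `∫^⊕ H_s dμ(s)`. -/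
def DirectIntegral : Type _ := F.l2Sections ⧸ F.nullSections

namespace DirectIntegral

instance : AddCommGroup F.DirectIntegral :=
  inferInstanceAs (AddCommGroup (F.l2Sections ⧸ F.nullSections))

instance : Module ℂ F.DirectIntegral :=
  inferInstanceAs (Module ℂ (F.l2Sections ⧸ F.nullSections))

variable {F}

/-- The class of a square integrable measurable section. -/
def mk : F.l2Sections →ₗ[ℂ] F.DirectIntegral := F.nullSections.mkQ

/-- A section that represents an element of the direct integral. -/
def rep (x : F.DirectIntegral) : F.l2Sections := Quotient.out x

/-- The value `x(s)` of (a representative of) `x`. -/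
def val (x : F.DirectIntegral) (s : Ω) : H s := (rep x).1 s

theorem mk_rep (x : F.DirectIntegral) : mk (rep x) = x := Quotient.out_eq x

theorem mk_eq_mk {x y : F.l2Sections} : mk x = mk y ↔ ∀ᵐ s ∂μ, x.1 s = y.1 s := by
  refine (Submodule.Quotient.eq F.nullSections).trans ?_
  change (∀ᵐ s ∂μ, (x - y).1 s = 0) ↔ _
  simp [sub_eq_zero]

theorem val_mk (x : F.l2Sections) : ∀ᵐ s ∂μ, (mk x).val s = x.1 s :=
  mk_eq_mk.1 (mk_rep (mk x))

theorem ext_ae {x y : F.DirectIntegral} (h : ∀ᵐ s ∂μ, x.val s = y.val s) : x = y := by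
  rw [← mk_rep x, ← mk_rep y]
  exact mk_eq_mk.2 h

theorem val_add (x y : F.DirectIntegral) :
    ∀ᵐ s ∂μ, (x + y).val s = x.val s + y.val s := by
  have h := val_mk (rep x + rep y)
  rwa [map_add, mk_rep, mk_rep] at h

theorem val_smul (c : ℂ) (x : F.DirectIntegral) :
    ∀ᵐ s ∂μ, (c • x).val s = c • x.val s := by
  have h := val_mk (c • rep x)
  rwa [map_smul, mk_rep] at h

theorem val_zero : ∀ᵐ s ∂μ, (0 : F.DirectIntegral).val s = 0 := by
  have h := val_mk (0 : F.l2Sections)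
  rwa [map_zero] at h

theorem integrable_inner (x y : F.DirectIntegral) :
    Integrable (fun s => inner ℂ (x.val s) (y.val s)) μ := by
  refine ((rep x).2.2.add (rep y).2.2).mono'
    (F.aemeasurable_inner _ (rep x).2.1 _ (rep y).2.1).aestronglyMeasurable
    (Eventually.of_forall fun s => ?_)
  have h := norm_inner_le_norm (𝕜 := ℂ) ((rep x).1 s) ((rep y).1 s)
  simp only [val, Pi.add_apply]
  nlinarith [sq_nonneg (‖(rep x).1 s‖ - ‖(rep y).1 s‖), sq_nonneg ‖(rep x).1 s‖,
    sq_nonneg ‖(rep y).1 s‖]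

/-- The inner product `⟨x, y⟩ = ∫ ⟨x(s), y(s)⟩ dμ(s)`. -/
abbrev core : InnerProductSpace.Core ℂ F.DirectIntegral where
  inner x y := ∫ s, inner ℂ (x.val s) (y.val s) ∂μ
  conj_inner_symm x y := by
    rw [← integral_conj]
    simp
  re_inner_nonneg x := by
    rw [← integral_re (integrable_inner x x)]
    exact integral_nonneg fun s => inner_self_nonneg
  add_left x y z := by
    rw [← integral_add (integrable_inner x z) (integrable_inner y z)]
    refine integral_congr_ae ?_
    filter_upwards [val_add x y] with s h
    rw [h, inner_add_left]
  smul_left x y c := by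
    rw [← integral_const_mul]
    refine integral_congr_ae ?_
    filter_upwards [val_smul c x] with s h
    rw [h, inner_smul_left]
  definite x hx := by
    have h1 : ∫ s, ‖x.val s‖ ^ 2 ∂μ = 0 := by
      have h2 := congrArg Complex.re hx
      rw [← RCLike.re_eq_complex_re, ← integral_re (integrable_inner x x)] at h2
      simpa only [inner_self_eq_norm_sq, RCLike.re_eq_complex_re, Complex.zero_re] using h2
    replace h1 := (integral_eq_zero_iff_of_nonneg (fun s => sq_nonneg _) (rep x).2.2).1 h1
    refine ext_ae ?_
    filter_upwards [h1, val_zero (F := F)] with s h h0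
    rw [h0]
    have h' : ‖x.val s‖ ^ 2 = 0 := h
    simpa using h'

instance : NormedAddCommGroup F.DirectIntegral :=
  InnerProductSpace.Core.toNormedAddCommGroup (cd := core)

instance : InnerProductSpace ℂ F.DirectIntegral :=
  InnerProductSpace.ofCore (core (F := F)).toCore

theorem inner_def (x y : F.DirectIntegral) :
    inner ℂ x y = ∫ s, inner ℂ (x.val s) (y.val s) ∂μ := rfl

theorem norm_sq_eq (x : F.DirectIntegral) : ‖x‖ ^ 2 = ∫ s, ‖x.val s‖ ^ 2 ∂μ := by
  rw [← inner_self_eq_norm_sq (𝕜 := ℂ) x, inner_def, ← integral_re (integrable_inner x x)]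
  simp only [inner_self_eq_norm_sq]

end DirectIntegral

/-! ### Direct integrals of operators -/

/-- A bounded measurable field of operators: `s ↦ ⟨T(s)x(s), y(s)⟩` is measurable for all
measurable sections `x`, `y`, and `s ↦ ‖T(s)‖` is essentially bounded. -/
def IsBoundedField (T : ∀ s, H s →L[ℂ] H s) : Prop :=
  (∀ x ∈ F.sections, ∀ y ∈ F.sections,
    AEMeasurable (fun s => inner ℂ (T s (x s)) (y s)) μ) ∧
  essSup (fun s => ‖T s‖ₑ) μ < ∞

/-- A measurable field of closed operators: for some `ν`, almost every `A(s)` has `ν` in its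
resolvent set, and the resolvents at `ν` (set to zero on the exceptional null set) form a
bounded measurable field of operators. -/
structure IsClosedField (A : ∀ s, H s →ₗ.[ℂ] H s) : Prop where
  isClosed : ∀ s, (A s).IsClosed
  exists_resolvent : ∃ ν : ℂ, (∀ᵐ s ∂μ, ν ∈ UnboundedOperator.resolventSet (A s)) ∧
    F.IsBoundedField fun s => UnboundedOperator.resolvent ν (A s)

/-- The pairs `(x, y)` with `x(s) ∈ D(A(s))` and `y(s) = A(s)x(s)` for almost every `s`. -/
def operatorGraph (A : ∀ s, H s →ₗ.[ℂ] H s) :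
    Submodule ℂ (F.DirectIntegral × F.DirectIntegral) where
  carrier := {p | ∀ᵐ s ∂μ, ∃ h : p.1.val s ∈ (A s).domain, p.2.val s = A s ⟨p.1.val s, h⟩}
  zero_mem' := by
    change ∀ᵐ s ∂μ, _
    filter_upwards [DirectIntegral.val_zero (F := F)] with s h
    refine ⟨by simp [h], ?_⟩
    have : (⟨(0 : F.DirectIntegral × F.DirectIntegral).1.val s, by simp [h]⟩ : (A s).domain)
        = 0 := Subtype.ext h
    rw [this, LinearPMap.map_zero]
    exact h
  add_mem' := by
    intro p q hp hq
    filter_upwards [hp, hq, DirectIntegral.val_add p.1 q.1, DirectIntegral.val_add p.2 q.2]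
      with s ⟨h1, e1⟩ ⟨h2, e2⟩ h3 h4
    have hm : (p + q).1.val s ∈ (A s).domain := by
      rw [Prod.fst_add, h3]
      exact add_mem h1 h2
    refine ⟨hm, ?_⟩
    have : (⟨(p + q).1.val s, hm⟩ : (A s).domain) = ⟨p.1.val s, h1⟩ + ⟨q.1.val s, h2⟩ :=
      Subtype.ext h3
    rw [this, LinearPMap.map_add, ← e1, ← e2]
    exact h4
  smul_mem' := by
    intro c p hp
    filter_upwards [hp, DirectIntegral.val_smul c p.1, DirectIntegral.val_smul c p.2]
      with s ⟨h1, e1⟩ h3 h4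
    have hm : (c • p).1.val s ∈ (A s).domain := by
      rw [Prod.smul_fst, h3]
      exact (A s).domain.smul_mem c h1
    refine ⟨hm, ?_⟩
    have : (⟨(c • p).1.val s, hm⟩ : (A s).domain) = c • ⟨p.1.val s, h1⟩ := Subtype.ext h3
    rw [this, LinearPMap.map_smul, ← e1]
    exact h4

/-- The direct integral `A = ∫^⊕ A(s) dμ(s)`: its domain consists of the `x` with
`x(s) ∈ D(A(s))` for a.e. `s` and `A(·)x(·)` in the direct integral, and `Ax = A(·)x(·)`. -/
def operator (A : ∀ s, H s →ₗ.[ℂ] H s) : F.DirectIntegral →ₗ.[ℂ] F.DirectIntegral :=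
  (F.operatorGraph A).toLinearPMap

theorem operatorGraph_functional (A : ∀ s, H s →ₗ.[ℂ] H s)
    (p : F.DirectIntegral × F.DirectIntegral) (hp : p ∈ F.operatorGraph A) (h0 : p.1 = 0) :
    p.2 = 0 := by
  refine DirectIntegral.ext_ae ?_
  have hp' : ∀ᵐ s ∂μ, ∃ h : p.1.val s ∈ (A s).domain, p.2.val s = A s ⟨p.1.val s, h⟩ := hp
  filter_upwards [hp', DirectIntegral.val_zero (F := F)] with s ⟨h, e⟩ hz
  have : (⟨p.1.val s, h⟩ : (A s).domain) = 0 := Subtype.ext (by simpa only [h0] using! hz)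
  rw [e, this, LinearPMap.map_zero, hz]

theorem mem_graph_operator {A : ∀ s, H s →ₗ.[ℂ] H s} {x y : F.DirectIntegral} :
    (x, y) ∈ (F.operator A).graph ↔
      ∀ᵐ s ∂μ, ∃ h : x.val s ∈ (A s).domain, y.val s = A s ⟨x.val s, h⟩ := by
  rw [operator, Submodule.toLinearPMap_graph_eq _ (F.operatorGraph_functional A)]
  rfl

end HilbertField

end

/-! Everything reduces to the bounded operators B(s) = 1 + (z - ν) R(ν, A(s)), formally (z - A(s))
R(ν, A(s)): z lies in ρ(A(s)) iff B(s) is invertible, with R(z) = R(ν) B⁻¹ and B⁻¹ = 1 - (z - ν)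
R(z). The same holds for the direct integral A.

If the resolvents at z are essentially bounded, then B(s) is uniformly bounded below. The solution
of B w = x is a pointwise limit of Landweber iterates, which are measurable sections, so w and R(z)
x = R(ν) w are measurable (`isBoundedField_resolvent`). Integrating the resolvents then inverts z -
A (`isResolventAt_toCLM`).

Conversely, if z ∈ ρ(A), the lower bound for the integrated operator is localised to indicators of
measurable sets, giving a lower bound for B(s) on the fundamental sequence; surjectivity puts that
sequence in the range of B(s). By density almost every B(s) is invertible, with one bound on the
inverses (`ae_mem_resolventSet`).

Part (ii) is the complement of (i), once {s : z ∈ ρ(A(s))} is known to be null-measurable; a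
countable test on the fundamental sequence shows this. -/

noncomputable section

namespace UnboundedOperator

/-! ### Resolvents at z expressed through the resolvent at ν -/

section Algebra

variable {E : Type*} [NormedAddCommGroup E] [NormedSpace ℂ E]

/-- The resolvent equation `R(ν) - R(z) = (z - ν) R(ν) R(z)`. -/
theorem IsResolventAt.resolvent_identity {B : E →ₗ.[ℂ] E} {ν z : ℂ} {R S : E →L[ℂ] E}
    (hR : IsResolventAt B ν R) (hS : IsResolventAt B z S) (y : E) :
    R y - S y = (z - ν) • R (S y) := by
  obtain ⟨h, hy⟩ := hS.1 y
  have h1 : R (ν • S y - B ⟨S y, h⟩) = S y := hR.2 ⟨S y, h⟩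
  have h2 : ν • S y - B ⟨S y, h⟩ = y - (z - ν) • S y := by
    linear_combination (norm := module) hy
  rw [h2, map_sub, map_smul] at h1
  linear_combination (norm := module) h1

/-- If `C` inverts `1 + (z - ν) R(ν)`, then `R(ν) C` is the resolvent at `z`. -/
theorem IsResolventAt.comp_of_inverse {B : E →ₗ.[ℂ] E} {ν z : ℂ} {R C : E →L[ℂ] E}
    (hR : IsResolventAt B ν R) (hr : ∀ y, C y + (z - ν) • R (C y) = y)
    (hl : ∀ y, C (y + (z - ν) • R y) = y) : IsResolventAt B z (R.comp C) := by
  refine ⟨fun y => ?_, fun x => ?_⟩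
  · obtain ⟨h, hy⟩ := hR.1 (C y)
    have key : z • R (C y) - B ⟨R (C y), h⟩ = y := by
      linear_combination (norm := module) hy + hr y
    exact ⟨h, key⟩
  · have h1 := hR.2 x
    set u := ν • (x : E) - B x with hu
    have h2 : z • (x : E) - B x = u + (z - ν) • R u := by
      rw [h1, hu, sub_smul]; abel
    rw [h2, ContinuousLinearMap.comp_apply, hl, h1]

/-- The inverse of (z - B) R(ν) = 1 + (z - ν) R(ν) is (ν - B) R(z) = 1 - (z - ν) R(z). This is the
resolvent identity with ν and z exchanged; the right inverse below uses it in the original order. -/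
theorem IsResolventAt.left_inverse {B : E →ₗ.[ℂ] E} {ν z : ℂ} {R S : E →L[ℂ] E}
    (hR : IsResolventAt B ν R) (hS : IsResolventAt B z S) (y : E) :
    (y + (z - ν) • R y) - (z - ν) • S (y + (z - ν) • R y) = y := by
  have h := hS.resolvent_identity hR y
  rw [map_add, map_smul]
  linear_combination (norm := module) (-(z - ν)) • h

theorem IsResolventAt.right_inverse {B : E →ₗ.[ℂ] E} {ν z : ℂ} {R S : E →L[ℂ] E}
    (hR : IsResolventAt B ν R) (hS : IsResolventAt B z S) (y : E) :
    (y - (z - ν) • S y) + (z - ν) • R (y - (z - ν) • S y) = y := by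
  rw [map_sub, map_smul, ← hR.resolvent_identity hS y]
  simp only [smul_sub]
  abel

theorem IsResolventAt.norm_le {B : E →ₗ.[ℂ] E} {ν z : ℂ} {R S : E →L[ℂ] E}
    (hR : IsResolventAt B ν R) (hS : IsResolventAt B z S) {K : ℝ} (hK : ‖S‖ ≤ K) (y : E) :
    ‖y‖ ≤ (1 + ‖z - ν‖ * K) * ‖y + (z - ν) • R y‖ := by
  nth_rewrite 1 [← hR.left_inverse hS y]
  refine (norm_sub_le _ _).trans ?_
  rw [norm_smul, add_mul, one_mul, mul_assoc]
  gcongr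
  exact S.le_of_opNorm_le hK _

end Algebra

/-! ### Invertibility from a lower bound and dense range -/

section BoundedBelow

variable {E : Type*} [NormedAddCommGroup E] [NormedSpace ℂ E]

theorem norm_le_mul_norm_apply_of_denseRange {ι : Type*} {ξ : ι → E} (hξ : DenseRange ξ)
    {B : E →L[ℂ] E} {K : ℝ} (h : ∀ i, ‖ξ i‖ ≤ K * ‖B (ξ i)‖) (x : E) : ‖x‖ ≤ K * ‖B x‖ :=
  hξ.induction_on (p := fun x => ‖x‖ ≤ K * ‖B x‖) x
    (isClosed_le continuous_norm (by fun_prop)) h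

theorem denseRange_of_forall_exists {E : Type*} [NormedAddCommGroup E] {ξ : ℕ → E} (hξ : DenseRange ξ) {f : E → E}
    (h : ∀ j n : ℕ, ∃ i, ‖f (ξ i) - ξ j‖ < 1 / ((n : ℝ) + 1)) : DenseRange f := by
  have h1 : Set.range ξ ⊆ closure (Set.range f) := by
    rintro _ ⟨j, rfl⟩
    refine Metric.mem_closure_iff.2 fun ε hε => ?_
    obtain ⟨n, hn⟩ := exists_nat_one_div_lt hε
    obtain ⟨i, hi⟩ := h j n
    exact ⟨f (ξ i), ⟨_, rfl⟩, by rw [dist_comm, dist_eq_norm]; exact hi.trans hn⟩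
  exact fun x => closure_minimal h1 isClosed_closure (hξ x)

/-- A lower bound gives injectivity and closed range, so dense range already means surjective; the
same constant bounds the inverse. -/
theorem exists_inverse_of_denseRange [CompleteSpace E] {B : E →L[ℂ] E} {K : ℝ}
    (hK : ∀ x, ‖x‖ ≤ K * ‖B x‖) (hd : DenseRange B) :
    ∃ C : E →L[ℂ] E, (∀ y, B (C y) = y) ∧ (∀ y, C (B y) = y) ∧ ∀ y, ‖C y‖ ≤ K * ‖y‖ := by
  have hb : Function.Bijective B := by
    rw [ContinuousLinearMap.bijective_iff_dense_range_and_antilipschitz]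
    refine ⟨?_, K.toNNReal, B.antilipschitz_of_bound fun x => (hK x).trans ?_⟩
    · rw [SetLike.ext'_iff]
      simpa using! hd.closure_eq
    · gcongr
      exact Real.le_coe_toNNReal K
  obtain ⟨u, rfl⟩ := ContinuousLinearMap.isUnit_iff_bijective.2 hb
  have h1 : ∀ y, (u : E →L[ℂ] E) ((↑u⁻¹ : E →L[ℂ] E) y) = y := fun y => by
    rw [← mul_apply_eq_comp, Units.mul_inv, one_apply_eq_self]
  refine ⟨(↑u⁻¹ : E →L[ℂ] E), h1, fun y => ?_, fun y => ?_⟩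
  · rw [← mul_apply_eq_comp, Units.inv_mul, one_apply_eq_self]
  · simpa only [h1] using hK ((↑u⁻¹ : E →L[ℂ] E) y)

end BoundedBelow

/-- With `R` the resolvent at `ν`, the point `z` belongs to the resolvent set if `1 + (z - ν) R`
is bounded below and has dense range. -/
theorem IsResolventAt.exists_resolvent {E : Type*} [NormedAddCommGroup E] [NormedSpace ℂ E]
    [CompleteSpace E] {B : E →ₗ.[ℂ] E} {ν z : ℂ} {R : E →L[ℂ] E} (hR : IsResolventAt B ν R)
    {K : ℝ} (hK : ∀ x, ‖x‖ ≤ K * ‖x + (z - ν) • R x‖)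
    (hd : DenseRange fun x => x + (z - ν) • R x) :
    ∃ S : E →L[ℂ] E, IsResolventAt B z S ∧ ∀ x, ‖S x‖ ≤ ‖R‖ * (K * ‖x‖) := by
  obtain ⟨C, hr, hl, hC⟩ := exists_inverse_of_denseRange
    (B := ContinuousLinearMap.id ℂ E + (z - ν) • R) (K := K) (by simpa using! hK)
    (by simpa using! hd)
  refine ⟨R.comp C, hR.comp_of_inverse (by simpa using! hr) (by simpa using! hl), fun x => ?_⟩
  exact (R.le_opNorm _).trans (by gcongr; exact hC x)

/-- A countable criterion for membership in the resolvent set, tested on a dense sequence. -/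
theorem IsResolventAt.mem_resolventSet_iff {E : Type*} [NormedAddCommGroup E] [NormedSpace ℂ E]
    [CompleteSpace E] {B : E →ₗ.[ℂ] E} {ν z : ℂ} {R : E →L[ℂ] E} (hR : IsResolventAt B ν R)
    {ξ : ℕ → E} (hξ : DenseRange ξ) :
    z ∈ resolventSet B ↔ ∃ K : ℕ, (∀ i, ‖ξ i‖ ≤ K * ‖ξ i + (z - ν) • R (ξ i)‖) ∧
      ∀ j n : ℕ, ∃ i, ‖ξ i + (z - ν) • R (ξ i) - ξ j‖ < 1 / ((n : ℝ) + 1) := by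
  constructor
  · rintro ⟨S, hS⟩
    -- The norm bound for 1 - (z - ν) S is rounded up to a natural number, so that the criterion
    -- quantifies over countable sets only.
    obtain ⟨K, hK⟩ := exists_nat_ge (1 + ‖z - ν‖ * ‖S‖)
    refine ⟨K, fun i => (hR.norm_le hS le_rfl _).trans (by gcongr), fun j n => ?_⟩
    have hsurj : Function.Surjective fun x => x + (z - ν) • R x :=
      fun y => ⟨_, hR.right_inverse hS y⟩
    have hd := hsurj.denseRange.comp hξ (by fun_prop)
    obtain ⟨i, hi⟩ := hd.exists_dist_lt (ξ j) (Nat.one_div_pos_of_nat (α := ℝ) (n := n))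
    exact ⟨i, by rwa [dist_comm, dist_eq_norm] at hi⟩
  · rintro ⟨K, h1, h2⟩
    obtain ⟨S, hS, -⟩ := hR.exists_resolvent (K := K) (z := z)
      (norm_le_mul_norm_apply_of_denseRange (B := ContinuousLinearMap.id ℂ E + (z - ν) • R) hξ h1)
      (denseRange_of_forall_exists hξ h2)
    exact ⟨S, hS⟩

end UnboundedOperator

end

noncomputable section

namespace HilbertField

variable {Ω : Type*} [MeasurableSpace Ω] {μ : Measure Ω} {H : Ω → Type*}
  [∀ s, NormedAddCommGroup (H s)] [∀ s, InnerProductSpace ℂ (H s)] {F : HilbertField μ H}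

open Topology

/-! ### Closure properties of measurable sections and bounded fields -/

theorem sub_mem_sections {x y : ∀ s, H s} (hx : x ∈ F.sections) (hy : y ∈ F.sections) :
    (fun s => x s - y s) ∈ F.sections := by
  refine F.mem_sections _ fun w hw => ?_
  simpa only [inner_sub_right] using!
    (F.aemeasurable_inner w hw x hx).sub (F.aemeasurable_inner w hw y hy)

theorem measurable_smul_mem_sections {φ : Ω → ℂ} (hφ : AEMeasurable φ μ) {x : ∀ s, H s}
    (hx : x ∈ F.sections) : (fun s => φ s • x s) ∈ F.sections := by
  refine F.mem_sections _ fun w hw => ?_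
  simpa only [inner_smul_right] using! hφ.mul (F.aemeasurable_inner w hw x hx)

theorem mem_sections_of_tendsto {y : ℕ → ∀ s, H s} {x : ∀ s, H s} (hy : ∀ n, y n ∈ F.sections)
    (h : ∀ᵐ s ∂μ, Tendsto (fun n => y n s) atTop (𝓝 (x s))) : x ∈ F.sections := by
  refine F.mem_sections _ fun w hw =>
    aemeasurable_of_tendsto_metrizable_ae atTop (fun n => F.aemeasurable_inner w hw _ (hy n)) ?_
  filter_upwards [h] with s hs
  exact tendsto_const_nhds.inner hs

theorem mem_sections_congr {x y : ∀ s, H s} (hx : x ∈ F.sections) (h : ∀ᵐ s ∂μ, x s = y s) :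
    y ∈ F.sections := by
  refine mem_sections_of_tendsto (y := fun _ => x) (fun _ => hx) ?_
  filter_upwards [h] with s hs
  rw [hs]
  exact tendsto_const_nhds

theorem aemeasurable_norm {x : ∀ s, H s} (hx : x ∈ F.sections) :
    AEMeasurable (fun s => ‖x s‖) μ := by
  simpa using (F.aemeasurable_norm_sq hx).sqrt

theorem essSup_enorm_lt_top_iff {E : Ω → Type*} [∀ s, NormedAddCommGroup (E s)]
    {f : ∀ s, E s} :
    essSup (fun s => ‖f s‖ₑ) μ < ∞ ↔ ∃ K : ℝ, 0 ≤ K ∧ ∀ᵐ s ∂μ, ‖f s‖ ≤ K := by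
  constructor
  · intro h
    refine ⟨(essSup (fun s => ‖f s‖ₑ) μ).toReal, ENNReal.toReal_nonneg, ?_⟩
    filter_upwards [ae_le_essSup (μ := μ) (f := fun s => ‖f s‖ₑ)] with s hs
    simpa using ENNReal.toReal_mono h.ne hs
  · rintro ⟨K, -, h⟩
    refine (essSup_le_of_ae_le (ENNReal.ofReal K) ?_).trans_lt ENNReal.ofReal_lt_top
    filter_upwards [h] with s hs
    rw [← ofReal_norm]
    exact ENNReal.ofReal_le_ofReal hs

theorem IsBoundedField.map_mem {T : ∀ s, H s →L[ℂ] H s} (hT : F.IsBoundedField T)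
    {x : ∀ s, H s} (hx : x ∈ F.sections) : (fun s => T s (x s)) ∈ F.sections := by
  refine F.mem_sections _ fun w hw => ?_
  have h := Complex.continuous_conj.measurable.comp_aemeasurable (hT.1 x hx w hw)
  refine h.congr (Eventually.of_forall fun s => ?_)
  exact inner_conj_symm _ _

theorem isBoundedField_of_map_mem {T : ∀ s, H s →L[ℂ] H s}
    (h : ∀ x ∈ F.sections, (fun s => T s (x s)) ∈ F.sections) {K : ℝ} (hK : 0 ≤ K)
    (hT : ∀ᵐ s ∂μ, ‖T s‖ ≤ K) : F.IsBoundedField T :=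
  ⟨fun x hx y hy => F.aemeasurable_inner _ (h x hx) y hy,
    essSup_enorm_lt_top_iff.2 ⟨K, hK, hT⟩⟩

theorem IsBoundedField.exists_bound {T : ∀ s, H s →L[ℂ] H s} (hT : F.IsBoundedField T) :
    ∃ K : ℝ, 0 ≤ K ∧ ∀ᵐ s ∂μ, ‖T s‖ ≤ K :=
  essSup_enorm_lt_top_iff.1 hT.2

/-- The identity ⟨w, T* x⟩ = ⟨T w, x⟩ transfers measurability to the adjoint, which the Landweber
iterates require. -/
theorem IsBoundedField.adjoint_map_mem [∀ s, CompleteSpace (H s)] {T : ∀ s, H s →L[ℂ] H s}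
    (hT : F.IsBoundedField T) {x : ∀ s, H s} (hx : x ∈ F.sections) :
    (fun s => ContinuousLinearMap.adjoint (T s) (x s)) ∈ F.sections := by
  refine F.mem_sections _ fun w hw => ?_
  simpa only [ContinuousLinearMap.adjoint_inner_right] using hT.1 w hw x hx

theorem IsBoundedField.id_add_smul {T : ∀ s, H s →L[ℂ] H s} (hT : F.IsBoundedField T) (c : ℂ) :
    F.IsBoundedField fun s => ContinuousLinearMap.id ℂ (H s) + c • T s := by
  obtain ⟨K, hK, h⟩ := hT.exists_bound
  refine isBoundedField_of_map_mem (K := 1 + ‖c‖ * K)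
    (fun x hx => F.add_mem_sections hx (F.smul_mem_sections c (hT.map_mem hx))) (by positivity) ?_
  filter_upwards [h] with s hs
  refine (norm_add_le _ _).trans (add_le_add ContinuousLinearMap.norm_id_le ?_)
  rw [norm_smul]
  gcongr

/-! ### Measurability of solutions by Landweber iteration -/

/-- The Landweber iteration contracts: `e ↦ e - c B* B e` is a strict contraction when `B` is
bounded below and `c ‖B‖² ≤ 1`. -/
theorem norm_sub_adjoint_apply_sq_le {E : Type*} [NormedAddCommGroup E] [InnerProductSpace ℂ E]
    [CompleteSpace E] {B : E →L[ℂ] E} {c K M : ℝ} (hc : 0 ≤ c) (hcM : c * M ^ 2 ≤ 1)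
    (hM : ‖B‖ ≤ M) (hK : 0 < K) (hB : ∀ x, ‖x‖ ≤ K * ‖B x‖) (e : E) :
    ‖e - (c : ℂ) • ContinuousLinearMap.adjoint B (B e)‖ ^ 2 ≤ (1 - c / K ^ 2) * ‖e‖ ^ 2 := by
  have hM0 : 0 ≤ M := (norm_nonneg _).trans hM
  have h1 : ‖ContinuousLinearMap.adjoint B (B e)‖ ≤ M * ‖B e‖ :=
    (ContinuousLinearMap.le_opNorm _ _).trans (by
      rw [LinearIsometryEquiv.norm_map]; gcongr)
  have h2 : RCLike.re (inner ℂ e ((c : ℂ) • ContinuousLinearMap.adjoint B (B e)))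
      = c * ‖B e‖ ^ 2 := by
    rw [inner_smul_right, ContinuousLinearMap.adjoint_inner_right]
    simp [inner_self_eq_norm_sq_to_K, ← Complex.ofReal_pow]
  rw [norm_sub_sq (𝕜 := ℂ), h2, norm_smul, Complex.norm_real, Real.norm_of_nonneg hc, mul_pow]
  have h3 : ‖ContinuousLinearMap.adjoint B (B e)‖ ^ 2 ≤ M ^ 2 * ‖B e‖ ^ 2 := by
    rw [← mul_pow]; gcongr
  have h4 : ‖e‖ ^ 2 / K ^ 2 ≤ ‖B e‖ ^ 2 := by
    rw [div_le_iff₀ (by positivity), ← mul_pow, mul_comm]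
    gcongr
    exact hB e
  -- Since c M² ≤ 1, the quadratic term absorbs only half of the cross term -2c‖Be‖², leaving ‖e‖² -
  -- c‖Be‖².
  have h5 : c ^ 2 * ‖ContinuousLinearMap.adjoint B (B e)‖ ^ 2 ≤ c * ‖B e‖ ^ 2 := calc
    _ ≤ c ^ 2 * (M ^ 2 * ‖B e‖ ^ 2) := by gcongr
    _ = (c * M ^ 2) * (c * ‖B e‖ ^ 2) := by ring
    _ ≤ 1 * (c * ‖B e‖ ^ 2) := by gcongr
    _ = _ := one_mul _
  have h6 : c * (‖e‖ ^ 2 / K ^ 2) ≤ c * ‖B e‖ ^ 2 := by gcongr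
  have h7 : (1 - c / K ^ 2) * ‖e‖ ^ 2 = ‖e‖ ^ 2 - c * (‖e‖ ^ 2 / K ^ 2) := by ring
  rw [h7]
  linarith

/-- The Landweber iterates for the equation `B y = x`. -/
def landweber [∀ s, CompleteSpace (H s)] (B : ∀ s, H s →L[ℂ] H s) (c : ℝ) (x : ∀ s, H s) :
    ℕ → ∀ s, H s
  | 0 => 0
  | n + 1 => fun s => landweber B c x n s -
      (c : ℂ) • ContinuousLinearMap.adjoint (B s) (B s (landweber B c x n s) - x s)

/-- If a bounded measurable field is uniformly bounded below, then a solution `y` of `B y = x`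
with measurable right-hand side is measurable. -/
theorem IsBoundedField.mem_sections_of_apply_eq [∀ s, CompleteSpace (H s)]
    {B : ∀ s, H s →L[ℂ] H s} (hB : F.IsBoundedField B) {K : ℝ}
    (hK : ∀ᵐ s ∂μ, ∀ x, ‖x‖ ≤ K * ‖B s x‖) {x y : ∀ s, H s} (hx : x ∈ F.sections)
    (hy : ∀ᵐ s ∂μ, B s (y s) = x s) : y ∈ F.sections := by
  obtain ⟨M, hM0, hM⟩ := hB.exists_bound
  -- No sign is assumed for K; the replacement is positive and still gives a lower bound.
  set K' : ℝ := |K| + 1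
  have hK'0 : 0 < K' := by positivity
  set c : ℝ := 1 / (M ^ 2 + 1)
  have hc : 0 < c := by positivity
  have hcM : c * M ^ 2 ≤ 1 := by
    rw [one_div_mul_eq_div, div_le_one (by positivity)]
    linarith
  have hmem : ∀ n, landweber B c x n ∈ F.sections := by
    intro n
    induction n with
    | zero => exact F.zero_mem_sections
    | succ n ih => exact sub_mem_sections ih (F.smul_mem_sections (c : ℂ)
        (hB.adjoint_map_mem (sub_mem_sections (hB.map_mem ih) hx)))
  refine mem_sections_of_tendsto hmem ?_
  filter_upwards [hM, hK, hy] with s hMs hKs hys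
  -- The maximum with 0 keeps the ratio in [0, 1), so that its powers can be multiplied through the
  -- induction.
  have hstep : ∀ e : H s, ‖e - (c : ℂ) • ContinuousLinearMap.adjoint (B s) (B s e)‖ ^ 2
      ≤ max (1 - c / K' ^ 2) 0 * ‖e‖ ^ 2 := fun e =>
    (norm_sub_adjoint_apply_sq_le hc.le hcM hMs hK'0 (fun x => (hKs x).trans (by
      gcongr; exact (le_abs_self K).trans (by simp [K']))) e).trans (by
        gcongr; exact le_max_left _ _)
  have hq : max (1 - c / K' ^ 2) 0 < 1 := by
    have : 0 < c / K' ^ 2 := by positivity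
    simp [this]
  have herr : ∀ n, ‖landweber B c x n s - y s‖ ^ 2
      ≤ max (1 - c / K' ^ 2) 0 ^ n * ‖y s‖ ^ 2 := by
    intro n
    induction n with
    | zero => simp [landweber]
    | succ n ih =>
      have h1 : landweber B c x (n + 1) s - y s = (landweber B c x n s - y s) -
          (c : ℂ) • ContinuousLinearMap.adjoint (B s) (B s (landweber B c x n s - y s)) := by
        rw [map_sub (B s), hys]
        simp only [landweber]
        abel
      rw [h1, pow_succ' (max _ _), mul_assoc]
      exact (hstep _).trans (by gcongr)
  rw [tendsto_iff_norm_sub_tendsto_zero]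
  have h2 : Tendsto (fun n => ‖landweber B c x n s - y s‖ ^ 2) atTop (𝓝 0) := by
    refine squeeze_zero (fun n => sq_nonneg _) herr ?_
    simpa using (tendsto_pow_atTop_nhds_zero_of_lt_one (le_max_right _ _) hq).mul_const
      (‖y s‖ ^ 2)
  simpa using h2.sqrt

/-! ### Square integrable sections -/

/-- Fundamental sections need not be square integrable. With g positive and integrable
(σ-finiteness), the weight √(g / (1 + ‖x‖²)) makes the squared norm at most g and, being nowhere
zero, can be divided out again. -/
theorem exists_pos_smul_mem_l2Sections [SigmaFinite μ] {x : ∀ s, H s} (hx : x ∈ F.sections) :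
    ∃ φ : Ω → ℂ, AEMeasurable φ μ ∧ (∀ s, φ s ≠ 0) ∧ (fun s => φ s • x s) ∈ F.l2Sections := by
  obtain ⟨g, hg0, hg, hgi⟩ := exists_pos_lintegral_lt_of_sigmaFinite μ one_ne_zero
  set ψ : Ω → ℝ := fun s => Real.sqrt (g s / (1 + ‖x s‖ ^ 2))
  have hψ : AEMeasurable ψ μ :=
    ((hg.coe_nnreal_real.aemeasurable).div ((F.aemeasurable_norm_sq hx).const_add 1)).sqrt
  have hψ0 : ∀ s, 0 < ψ s := fun s => Real.sqrt_pos.2 (by have := hg0 s; positivity)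
  have hφ : AEMeasurable (fun s => (ψ s : ℂ)) μ := Complex.measurable_ofReal.comp_aemeasurable hψ
  have hmem := measurable_smul_mem_sections hφ hx
  refine ⟨fun s => (ψ s : ℂ), hφ, fun s => Complex.ofReal_ne_zero.2 (hψ0 s).ne', hmem, ?_⟩
  have hgint : Integrable (fun s => (g s : ℝ)) μ := by
    refine ⟨hg.coe_nnreal_real.aestronglyMeasurable, ?_⟩
    simpa [HasFiniteIntegral] using hgi.trans ENNReal.one_lt_top
  refine hgint.mono' (F.aemeasurable_norm_sq hmem).aestronglyMeasurable
    (Eventually.of_forall fun s => ?_)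
  rw [Real.norm_of_nonneg (sq_nonneg _), norm_smul, Complex.norm_real,
    Real.norm_of_nonneg (hψ0 s).le, mul_pow, Real.sq_sqrt (by positivity), div_mul_eq_mul_div,
    div_le_iff₀ (by positivity)]
  have := (g s).coe_nonneg
  nlinarith

theorem indicator_mem_l2Sections {x : ∀ s, H s} (hx : x ∈ F.l2Sections) {E : Set Ω}
    (hE : MeasurableSet E) :
    (fun s => E.indicator (1 : Ω → ℂ) s • x s) ∈ F.l2Sections := by
  have hmem := measurable_smul_mem_sections (F := F)
    ((measurable_one.indicator hE).aemeasurable : AEMeasurable (E.indicator (1 : Ω → ℂ)) μ) hx.1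
  refine ⟨hmem, hx.2.mono' (F.aemeasurable_norm_sq hmem).aestronglyMeasurable
    (Eventually.of_forall fun s => ?_)⟩
  by_cases h : s ∈ E <;> simp [h]

theorem IsBoundedField.map_mem_l2Sections {T : ∀ s, H s →L[ℂ] H s} (hT : F.IsBoundedField T)
    {x : ∀ s, H s} (hx : x ∈ F.l2Sections) : (fun s => T s (x s)) ∈ F.l2Sections := by
  obtain ⟨K, hK, h⟩ := hT.exists_bound
  have hmem := hT.map_mem hx.1
  refine ⟨hmem, (hx.2.const_mul (K ^ 2)).mono'
    (F.aemeasurable_norm_sq hmem).aestronglyMeasurable ?_⟩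
  filter_upwards [h] with s hs
  rw [Real.norm_of_nonneg (sq_nonneg _), ← mul_pow]
  gcongr
  exact (T s).le_of_opNorm_le hs _

/-- If `‖1_E x‖ ≤ K ‖1_E y‖` in the direct integral for every measurable set `E`, then
`‖x(s)‖ ≤ K ‖y(s)‖` for almost every `s`. -/
theorem ae_norm_le_of_forall_indicator {x y : ∀ s, H s} (hx : x ∈ F.l2Sections)
    (hy : y ∈ F.l2Sections) {K : ℝ} (hK : 0 ≤ K)
    (h : ∀ E (hE : MeasurableSet E),
      ‖DirectIntegral.mk ⟨_, indicator_mem_l2Sections hx hE⟩‖ ≤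
        K * ‖DirectIntegral.mk ⟨_, indicator_mem_l2Sections hy hE⟩‖) :
    ∀ᵐ s ∂μ, ‖x s‖ ≤ K * ‖y s‖ := by
  have key : ∀ {z : ∀ s, H s} (hz : z ∈ F.l2Sections) E (hE : MeasurableSet E),
      ‖DirectIntegral.mk ⟨_, indicator_mem_l2Sections hz hE⟩‖ ^ 2 = ∫ s in E, ‖z s‖ ^ 2 ∂μ := by
    intro z hz E hE
    rw [DirectIntegral.norm_sq_eq, ← integral_indicator hE]
    refine integral_congr_ae ?_
    filter_upwards [DirectIntegral.val_mk ⟨_, indicator_mem_l2Sections hz hE⟩] with s hs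
    rw [hs]
    by_cases hsE : s ∈ E <;> simp [hsE]
  -- Squaring turns the hypothesis into an inequality between integrals over every E, which forces
  -- the integrands to compare almost everywhere.
  have h1 := ae_le_of_forall_setIntegral_le hx.2 (hy.2.const_mul (K ^ 2)) fun E hE _ => by
    rw [integral_const_mul, ← key hx E hE, ← key hy E hE, ← mul_pow]
    have := h E hE
    gcongr
  filter_upwards [h1] with s hs
  rw [← mul_pow] at hs
  exact le_of_sq_le_sq hs (by positivity)

/-! ### The operator on the direct integral given by a bounded measurable field -/

/-- The operator `∫^⊕ T(s) dμ(s)` for a bounded measurable field `T`. -/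
def IsBoundedField.toCLM {T : ∀ s, H s →L[ℂ] H s} (hT : F.IsBoundedField T) :
    F.DirectIntegral →L[ℂ] F.DirectIntegral :=
  LinearMap.mkContinuousOfExistsBound
    { toFun := fun x => DirectIntegral.mk ⟨_, hT.map_mem_l2Sections (DirectIntegral.rep x).2⟩
      map_add' := fun x y => by
        rw [← map_add]
        refine DirectIntegral.mk_eq_mk.2 ?_
        filter_upwards [DirectIntegral.val_add x y] with s hs
        exact (congrArg (T s) hs).trans (map_add _ _ _)
      map_smul' := fun c x => by
        rw [← map_smul]
        refine DirectIntegral.mk_eq_mk.2 ?_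
        filter_upwards [DirectIntegral.val_smul c x] with s hs
        exact (congrArg (T s) hs).trans (map_smul _ _ _) }
    (by
      obtain ⟨K, hK, h⟩ := hT.exists_bound
      refine ⟨K, fun x => le_of_sq_le_sq ?_ (by positivity)⟩
      rw [mul_pow, DirectIntegral.norm_sq_eq, DirectIntegral.norm_sq_eq, ← integral_const_mul]
      refine integral_mono_ae (DirectIntegral.rep _).2.2
        ((DirectIntegral.rep x).2.2.const_mul (K ^ 2)) ?_
      filter_upwards [h, DirectIntegral.val_mk
        ⟨_, hT.map_mem_l2Sections (DirectIntegral.rep x).2⟩] with s hs hv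
      refine (congrArg (fun v => ‖v‖ ^ 2) hv).trans_le ?_
      simp only [← mul_pow]
      gcongr
      exact (T s).le_of_opNorm_le hs _)

theorem IsBoundedField.val_toCLM {T : ∀ s, H s →L[ℂ] H s} (hT : F.IsBoundedField T)
    (x : F.DirectIntegral) : ∀ᵐ s ∂μ, (hT.toCLM x).val s = T s (x.val s) :=
  DirectIntegral.val_mk ⟨_, hT.map_mem_l2Sections (DirectIntegral.rep x).2⟩

end HilbertField

end

noncomputable section

/-! ### Resolvent set and resolvent of the direct integral -/

namespace HilbertField

open UnboundedOperator

variable {Ω : Type*} [MeasurableSpace Ω] {μ : Measure Ω} {H : Ω → Type*}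
  [∀ s, NormedAddCommGroup (H s)] [∀ s, InnerProductSpace ℂ (H s)] {F : HilbertField μ H}

theorem IsBoundedField.ofBounded_toCLM {T : ∀ s, H s →L[ℂ] H s} (hT : F.IsBoundedField T) :
    ofBounded hT.toCLM = F.operator fun s => ofBounded (T s) := by
  refine LinearPMap.eq_of_eq_graph (Submodule.ext fun ⟨x, y⟩ => ?_)
  rw [mem_graph_operator, LinearPMap.mem_graph_iff]
  constructor
  · rintro ⟨w, rfl, rfl⟩
    filter_upwards [hT.val_toCLM w] with s hs
    exact ⟨Submodule.mem_top, hs⟩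
  · intro h
    refine ⟨⟨x, Submodule.mem_top⟩, rfl, DirectIntegral.ext_ae ?_⟩
    filter_upwards [h, hT.val_toCLM x] with s ⟨_, hs⟩ hs'
    exact hs'.trans hs.symm

variable {A : ∀ s, H s →ₗ.[ℂ] H s}

theorem DirectIntegral.val_smul_sub (z : ℂ) (x y : F.DirectIntegral) :
    ∀ᵐ s ∂μ, (z • x - y).val s = z • x.val s - y.val s := by
  filter_upwards [val_add (z • x) ((-1 : ℂ) • y), val_smul z x, val_smul (-1) y] with s h1 h2 h3
  rw [neg_one_smul ℂ y, ← sub_eq_add_neg] at h1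
  rw [h1, h2, ← neg_one_smul ℂ y, h3, neg_one_smul, sub_eq_add_neg]

/-- The direct integral of the resolvents is the resolvent of the direct integral. -/
theorem IsBoundedField.isResolventAt_toCLM {T : ∀ s, H s →L[ℂ] H s} (hT : F.IsBoundedField T)
    {z : ℂ} (h : ∀ᵐ s ∂μ, IsResolventAt (A s) z (T s)) :
    IsResolventAt (F.operator A) z hT.toCLM := by
  refine ⟨fun y => ?_, fun x => ?_⟩
  -- Domain membership and the value of the operator are both read off from one graph point, which
  -- can be checked fibrewise.
  · have hg : (hT.toCLM y, z • hT.toCLM y - y) ∈ (F.operator A).graph := by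
      rw [mem_graph_operator]
      filter_upwards [h, hT.val_toCLM y, DirectIntegral.val_smul_sub z (hT.toCLM y) y]
        with s hs h1 h2
      obtain ⟨hm, he⟩ := hs.1 (y.val s)
      refine ⟨h1 ▸ hm, ?_⟩
      have h3 : (⟨(hT.toCLM y).val s, h1 ▸ hm⟩ : (A s).domain) = ⟨T s (y.val s), hm⟩ :=
        Subtype.ext h1
      rw [h3, h2, h1, sub_eq_iff_eq_add, ← sub_eq_iff_eq_add', he]
    obtain ⟨w, hw1, hw2⟩ := (LinearPMap.mem_graph_iff _).1 hg
    have hm : hT.toCLM y ∈ (F.operator A).domain := by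
      rw [← show (w : F.DirectIntegral) = hT.toCLM y from hw1]
      exact w.2
    refine ⟨hm, ?_⟩
    have h3 : w = ⟨hT.toCLM y, hm⟩ := Subtype.ext hw1
    rw [← h3, show F.operator A w = _ from hw2, sub_sub_cancel]
  · have hg := mem_graph_operator F |>.1 ((F.operator A).mem_graph x)
    refine DirectIntegral.ext_ae ?_
    filter_upwards [h, hg, hT.val_toCLM (z • (x : F.DirectIntegral) - F.operator A x),
      DirectIntegral.val_smul_sub z (x : F.DirectIntegral) (F.operator A x)]
      with s hs ⟨hm, he⟩ h1 h2
    rw [h1, h2, he]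
    exact hs.2 ⟨_, hm⟩

variable [∀ s, CompleteSpace (H s)]

/-- If `ν` is in almost every resolvent set with a bounded measurable field of resolvents, then
the resolvents at another point form a bounded measurable field as soon as they are bounded. -/
theorem isBoundedField_resolvent {ν z : ℂ} (hν : ∀ᵐ s ∂μ, ν ∈ resolventSet (A s))
    (hR : F.IsBoundedField fun s => resolvent ν (A s)) (hz : ∀ᵐ s ∂μ, z ∈ resolventSet (A s))
    (hb : essSup (fun s => ‖resolvent z (A s)‖ₑ) μ < ∞) :
    F.IsBoundedField fun s => resolvent z (A s) := by
  obtain ⟨K, hK0, hK⟩ := essSup_enorm_lt_top_iff.1 hb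
  refine isBoundedField_of_map_mem (fun x hx => ?_) hK0 hK
  have hB := hR.id_add_smul (z - ν)
  -- This section is B⁻¹ x. It is measurable because it solves B w = x, and R(ν) maps it to R(z) x.
  have hw : (fun s => x s - (z - ν) • resolvent z (A s) (x s)) ∈ F.sections := by
    refine hB.mem_sections_of_apply_eq (K := 1 + ‖z - ν‖ * K) ?_ hx ?_
    · filter_upwards [hν, hz, hK] with s h1 h2 h3 y
      exact (isResolventAt_resolvent h1).norm_le (isResolventAt_resolvent h2) h3 y
    · filter_upwards [hν, hz] with s h1 h2
      exact (isResolventAt_resolvent h1).right_inverse (isResolventAt_resolvent h2) (x s)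
  refine mem_sections_congr (hR.map_mem hw) ?_
  filter_upwards [hν, hz] with s h1 h2
  rw [map_sub, map_smul, ← (isResolventAt_resolvent h1).resolvent_identity
    (isResolventAt_resolvent h2), sub_sub_cancel]

/-- By `mem_resolventSet_iff` the set agrees, off the null set where ν fails, with countable unions
and intersections of comparisons between a.e. measurable norms. -/
theorem nullMeasurableSet_mem_resolventSet {ν : ℂ} (hν : ∀ᵐ s ∂μ, ν ∈ resolventSet (A s))
    (hR : F.IsBoundedField fun s => resolvent ν (A s)) (z : ℂ) :
    NullMeasurableSet {s | z ∈ resolventSet (A s)} μ := by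
  obtain ⟨ξ, hξ, hd⟩ := F.exists_fundamental
  have hB := hR.id_add_smul (z - ν)
  have h1 : NullMeasurableSet {s | ∃ K : ℕ,
      (∀ i, ‖ξ i s‖ ≤ K * ‖ξ i s + (z - ν) • resolvent ν (A s) (ξ i s)‖) ∧
      ∀ j n : ℕ, ∃ i, ‖ξ i s + (z - ν) • resolvent ν (A s) (ξ i s) - ξ j s‖
        < 1 / ((n : ℝ) + 1)} μ := by
    simp only [Set.ofPred_exists, Set.ofPred_and, Set.ofPred_forall]
    refine .iUnion fun K => .inter (.iInter fun i => ?_)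
      (.iInter fun j => .iInter fun n => .iUnion fun i => ?_)
    · exact nullMeasurableSet_le (aemeasurable_norm (hξ i))
        ((aemeasurable_norm (hB.map_mem (hξ i))).const_mul _)
    · exact nullMeasurableSet_lt
        (aemeasurable_norm (sub_mem_sections (hB.map_mem (hξ i)) (hξ j))) aemeasurable_const
  refine h1.congr ?_
  filter_upwards [hν] with s hs
  exact propext ((isResolventAt_resolvent hs).mem_resolventSet_iff fun x => hd s x).symm

/-- A point of the resolvent set of the direct integral lies in almost every resolvent set, with
essentially bounded resolvents. -/
theorem ae_mem_resolventSet [SigmaFinite μ] {ν z : ℂ} (hν : ∀ᵐ s ∂μ, ν ∈ resolventSet (A s))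
    (hR : F.IsBoundedField fun s => resolvent ν (A s)) (hz : z ∈ resolventSet (F.operator A)) :
    (∀ᵐ s ∂μ, z ∈ resolventSet (A s)) ∧ essSup (fun s => ‖resolvent z (A s)‖ₑ) μ < ∞ := by
  obtain ⟨S, hS⟩ := hz
  obtain ⟨ξ, hξ, hd⟩ := F.exists_fundamental
  have hRν : IsResolventAt (F.operator A) ν hR.toCLM :=
    hR.isResolventAt_toCLM (hν.mono fun s hs => isResolventAt_resolvent hs)
  have hB := hR.id_add_smul (z - ν)
  have hval : ∀ u : F.DirectIntegral, ∀ᵐ s ∂μ, (u + (z - ν) • hR.toCLM u).val s =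
      u.val s + (z - ν) • resolvent ν (A s) (u.val s) := by
    intro u
    filter_upwards [DirectIntegral.val_add u ((z - ν) • hR.toCLM u),
      DirectIntegral.val_smul (z - ν) (hR.toCLM u), hR.val_toCLM u] with s h1 h2 h3
    rw [h1, h2, h3]
  set K : ℝ := 1 + ‖z - ν‖ * ‖S‖
  have hK0 : 0 ≤ K := by positivity
  choose φ hφ hφ0 hφξ using fun i => exists_pos_smul_mem_l2Sections (hξ i)
  -- The lower bound for the integrated operator is tested on 1_E φ_i ξ_i for all measurable E;
  -- multiplication by 1_E commutes with the field, and the nonzero factor φ_i(s) cancels at the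
  -- end.
  have hbelow : ∀ i, ∀ᵐ s ∂μ, ‖ξ i s‖ ≤ K * ‖ξ i s + (z - ν) • resolvent ν (A s) (ξ i s)‖ := by
    intro i
    have h := ae_norm_le_of_forall_indicator (hφξ i) (hB.map_mem_l2Sections (hφξ i)) hK0
      fun E hE => by
        refine (hRν.norm_le hS le_rfl _).trans_eq ?_
        congr 2
        refine DirectIntegral.ext_ae ?_
        filter_upwards [hval (DirectIntegral.mk ⟨_, indicator_mem_l2Sections (hφξ i) hE⟩),
          DirectIntegral.val_mk ⟨_, indicator_mem_l2Sections (hφξ i) hE⟩,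
          DirectIntegral.val_mk ⟨_, indicator_mem_l2Sections
            (hB.map_mem_l2Sections (hφξ i)) hE⟩] with s h1 h2 h3
        rw [h1, h2, h3]
        simp only [map_smul, _root_.add_apply, ContinuousLinearMap.id_apply,
          _root_.smul_apply]
        module
    filter_upwards [h] with s hs
    have h1 : (ContinuousLinearMap.id ℂ (H s) + (z - ν) • resolvent ν (A s)) (φ i s • ξ i s) =
        φ i s • (ξ i s + (z - ν) • resolvent ν (A s) (ξ i s)) := map_smul _ _ _
    rw [h1, norm_smul, norm_smul, mul_left_comm] at hs
    exact le_of_mul_le_mul_left hs (norm_pos_iff.2 (hφ0 i s))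
  -- The preimage of u = φ_j ξ_j under the integrated operator is u - (z - ν) S u; dividing its
  -- value at s by φ_j(s) gives a preimage of ξ_j(s).
  have hrange : ∀ j, ∀ᵐ s ∂μ, ∃ x, x + (z - ν) • resolvent ν (A s) x = ξ j s := by
    intro j
    set u : F.DirectIntegral := DirectIntegral.mk ⟨_, hφξ j⟩
    filter_upwards [hval (u - (z - ν) • S u), DirectIntegral.val_mk ⟨_, hφξ j⟩] with s h1 h2
    rw [hRν.right_inverse hS u, h2] at h1
    refine ⟨(φ j s)⁻¹ • (u - (z - ν) • S u).val s, ?_⟩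
    rw [map_smul, smul_comm, ← smul_add, ← h1, inv_smul_smul₀ (hφ0 j s)]
  obtain ⟨M, hM0, hM⟩ := hR.exists_bound
  -- Only countably many null sets are discarded. In M * K the factor M bounds R(ν, A(s)) and K
  -- bounds the inverse of B(s).
  have key : ∀ᵐ s ∂μ, z ∈ resolventSet (A s) ∧ ‖resolvent z (A s)‖ ≤ M * K := by
    filter_upwards [hν, ae_all_iff.2 hbelow, ae_all_iff.2 hrange, hM] with s h1 h2 h3 h4
    obtain ⟨T, hT, hTn⟩ := (isResolventAt_resolvent h1).exists_resolvent (z := z)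
      (norm_le_mul_norm_apply_of_denseRange
        (B := ContinuousLinearMap.id ℂ (H s) + (z - ν) • resolvent ν (A s)) (hd s) h2)
      ((hd s).mono (Set.range_subset_iff.2 h3))
    have hzs : z ∈ resolventSet (A s) := ⟨T, hT⟩
    refine ⟨hzs, ?_⟩
    rw [isResolventAt_unique (isResolventAt_resolvent hzs) hT]
    refine T.opNorm_le_bound (by positivity) fun x => (hTn x).trans ?_
    rw [mul_assoc]
    gcongr
  exact ⟨key.mono fun s h => h.1,
    essSup_enorm_lt_top_iff.2 ⟨M * K, by positivity, key.mono fun s h => h.2⟩⟩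

/-- If `z` is not in almost every resolvent set, then it is in the spectrum on a measurable set
of positive measure. -/
theorem exists_measurableSet_mem_spectrum {ν z : ℂ} (hν : ∀ᵐ s ∂μ, ν ∈ resolventSet (A s))
    (hR : F.IsBoundedField fun s => resolvent ν (A s))
    (hz : ¬ ∀ᵐ s ∂μ, z ∈ resolventSet (A s)) :
    ∃ G : Set Ω, MeasurableSet G ∧ 0 < μ G ∧ ∀ s ∈ G, z ∈ UnboundedOperator.spectrum (A s) := by
  -- A truly measurable set is taken inside the null-measurable one, so that z is in the spectrum at
  -- every point of G and not merely almost every one.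
  obtain ⟨G, hG, hGm, hGe⟩ :=
    (nullMeasurableSet_mem_resolventSet hν hR z).compl.exists_measurable_subset_ae_eq
  refine ⟨G, hGm, ?_, fun s hs => hG hs⟩
  rw [measure_congr hGe, pos_iff_ne_zero]
  exact hz

end HilbertField

end

theorem mainTheorem11 {Ω : Type*} [TopologicalSpace Ω] [LocallyCompactSpace Ω] [T2Space Ω]
    [MeasurableSpace Ω] [BorelSpace Ω] (μ : Measure Ω) [SigmaFinite μ]
    {H : Ω → Type*} [∀ s, NormedAddCommGroup (H s)] [∀ s, InnerProductSpace ℂ (H s)]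
    [∀ s, CompleteSpace (H s)] (F : HilbertField μ H)
    (A : ∀ s, H s →ₗ.[ℂ] H s) (hA : F.IsClosedField A) :
    (UnboundedOperator.resolventSet (F.operator A) =
        {z : ℂ | (∀ᵐ s ∂μ, z ∈ UnboundedOperator.resolventSet (A s)) ∧
          essSup (fun s => ‖UnboundedOperator.resolvent z (A s)‖ₑ) μ < ∞}) ∧
    (∀ z ∈ UnboundedOperator.resolventSet (F.operator A),
        F.IsBoundedField (fun s => UnboundedOperator.resolvent z (A s)) ∧
        UnboundedOperator.ofBounded (UnboundedOperator.resolvent z (F.operator A)) =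
          F.operator (fun s =>
            UnboundedOperator.ofBounded (UnboundedOperator.resolvent z (A s)))) ∧
    (UnboundedOperator.spectrum (F.operator A) =
        {z : ℂ | ∃ G : Set Ω, MeasurableSet G ∧ 0 < μ G ∧
          ∀ s ∈ G, z ∈ UnboundedOperator.spectrum (A s)} ∪
        {z : ℂ | (∀ᵐ s ∂μ, z ∈ UnboundedOperator.resolventSet (A s)) ∧
          essSup (fun s => ‖UnboundedOperator.resolvent z (A s)‖ₑ) μ = ∞}) := by
  obtain ⟨ν, hν, hR⟩ := hA.exists_resolvent
  have hbdd : ∀ z, ((∀ᵐ s ∂μ, z ∈ UnboundedOperator.resolventSet (A s)) ∧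
      essSup (fun s => ‖UnboundedOperator.resolvent z (A s)‖ₑ) μ < ∞) →
      ∃ hT : F.IsBoundedField (fun s => UnboundedOperator.resolvent z (A s)),
        UnboundedOperator.IsResolventAt (F.operator A) z hT.toCLM := fun z hz =>
    have hT := HilbertField.isBoundedField_resolvent hν hR hz.1 hz.2
    ⟨hT, hT.isResolventAt_toCLM
      (hz.1.mono fun s hs => UnboundedOperator.isResolventAt_resolvent hs)⟩
  have hset : UnboundedOperator.resolventSet (F.operator A) =
      {z : ℂ | (∀ᵐ s ∂μ, z ∈ UnboundedOperator.resolventSet (A s)) ∧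
        essSup (fun s => ‖UnboundedOperator.resolvent z (A s)‖ₑ) μ < ∞} :=
    Set.Subset.antisymm (fun z hz => HilbertField.ae_mem_resolventSet hν hR hz) fun z hz =>
      have ⟨_, h⟩ := hbdd z hz
      ⟨_, h⟩
  refine ⟨hset, fun z hz => ?_, ?_⟩
  · obtain ⟨hT, h⟩ := hbdd z (hset.subset hz)
    refine ⟨hT, ?_⟩
    rw [UnboundedOperator.isResolventAt_unique
      (UnboundedOperator.isResolventAt_resolvent hz) h, hT.ofBounded_toCLM]
  · ext z
    rw [UnboundedOperator.spectrum, hset]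
    constructor
    · intro hz
      by_cases h : ∀ᵐ s ∂μ, z ∈ UnboundedOperator.resolventSet (A s)
      · exact Or.inr ⟨h, not_lt_top_iff.1 fun h' => hz ⟨h, h'⟩⟩
      · exact Or.inl (HilbertField.exists_measurableSet_mem_spectrum hν hR h)
    · rintro (⟨G, -, hG0, hG⟩ | ⟨-, h⟩) ⟨h1, h2⟩
      · exact hG0.ne' (measure_mono_null (fun s hs => hG s hs) h1)
      · exact h2.ne h
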